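/- Let $p$ be a prime number, let $\xi$ be a primitive $p$-th root of unity in the field $\mathbb{Q}(\xi)$, and let $\mathcal{O}=\mathbb{Z}[\xi]$. Let $G=\langle\phi\rangle$ be a group of order $p$ acting linearly on a free $\mathbb{Z}$-module $T$ of finite rank. Each ideal $A$ of $\mathcal{O}$ is regarded as a $\mathbb{Z}[G]$-module by $\phi\cdot x=\xi x$. For $a\in A$, let $(A,a)$ be the $\mathbb{Z}$-module $A\oplus\mathbb{Z}$ with the action $\phi\cdot(x,k)=(\xi x+ka,\,k)$. A Curtis--Reiner decomposition of $T$ of type $(r,s,t)$ is an isomorphism of $\mathbb{Z}[G]$-modules $$T\simeq\bigoplus_{i=1}^{r}(A_i,a_i)\oplus\bigoplus_{i=r+1}^{r+s}A_i\oplus\mathbb{Z}^{\oplus t},$$ where the $A_i$ are nonzero ideals of $\mathcal{O}$, where $a_i\in A_i$ and $a_i\notin(\xi-1)A_i$ for $1\le i\le r$, and where $G$ acts trivially on $\mathbb{Z}^{\oplus t}$. For $1\le q\le p$ let $N_q$ be the $\mathbb{F}_p[G]$-module $\mathbb{F}_p^q$ on which $\phi$ acts by the $q\times q$ matrix with ones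 on the diagonal and on the superdiagonal and zeros elsewhere. Then $T$ has a Curtis--Reiner decomposition, and $T\otimes\mathbb{F}_p$ has a Jordan decomposition $T\otimes\mathbb{F}_p\simeq\bigoplus_{q=1}^{p}N_q^{\oplus\ell_q}$ as an $\mathbb{F}_p[G]$-module. For every Curtis--Reiner decomposition of $T$, of type $(r,s,t)$, and every Jordan decomposition of $T\otimes\mathbb{F}_p$, with block counts $\ell_q$, put $\ell_-=s$ and $\ell_+=t$. Then: 1. $\ell_p=r$; 2. if $p\ge 3$, then $\ell_1=\ell_+$ and $\ell_{p-1}=\ell_-$; 3. if $p=2$, then $\ell_1=\ell_++\ell_-$; 4. $\ell_q=0$ for all $2\le q\le p-2$; 5. $\operatorname{rk}T=\ell_++(p-1)\ell_-+p\,\ell_p$ and $\operatorname{rk}T^G=\ell_++\ell_p$, where $T^G$ is the submodule of $G$-invariants. In particular $r,s,t$ and $\ell_1,\dots,\ell_p$ depend only on the $\mathbb{Z}[G]$-module $T$. -/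

import Mathlib

namespace CurtisReiner

/-- The ring `ℤ[ξ]` generated by `ξ` inside the field `K`. -/
abbrev RootRing {K : Type*} [Field K] (ξ : K) : Subalgebra ℤ K := Algebra.adjoin ℤ {ξ}

/-- The element `ξ` of the ring `ℤ[ξ]`. -/
def root {K : Type*} [Field K] (ξ : K) : RootRing ξ :=
  ⟨ξ, Algebra.self_mem_adjoin_singleton ℤ ξ⟩

/-- The action `x ↦ ξ x` of the generator of `G` on an ideal `A` of `ℤ[ξ]`. -/
def idealAction {K : Type*} [Field K] {ξ : K} (A : Ideal (RootRing ξ)) : A →ₗ[ℤ] A :=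
  DistribSMul.toLinearMap ℤ A (root ξ)

/-- The action `(x, k) ↦ (ξ x + k a, k)` of the generator of `G` on `(A, a) = A ⊕ ℤ`. -/
def extensionAction {K : Type*} [Field K] {ξ : K} (A : Ideal (RootRing ξ)) (a : A) :
    (A × ℤ) →ₗ[ℤ] (A × ℤ) :=
  LinearMap.prod
    ((idealAction A).comp (LinearMap.fst ℤ A ℤ) + (LinearMap.snd ℤ A ℤ).smulRight a)
    (LinearMap.snd ℤ A ℤ)

/-- The abelian group `T` with the endomorphism `f` (the action of the chosen generator) is
equivariantly isomorphic to
`(A₁, a₁) ⊕ ⋯ ⊕ (A_r, a_r) ⊕ B₁ ⊕ ⋯ ⊕ B_s ⊕ ℤ^t`,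
where the `A_i` and `B_j` are nonzero ideals of `ℤ[ξ]` and `a_i ∈ A_i` is not in `(ξ - 1) A_i`
(which already forces `A_i ≠ 0`), and `ℤ^t` carries the trivial action. -/
def HasDecomposition {K : Type*} [Field K] (ξ : K) {T : Type*} [AddCommGroup T]
    (f : T →ₗ[ℤ] T) (r s t : ℕ) : Prop :=
  ∃ (A : Fin r → Ideal (RootRing ξ)) (a : ∀ i, A i) (B : Fin s → Ideal (RootRing ξ))
    (e : T ≃ₗ[ℤ] ((∀ i, (A i × ℤ)) × (∀ j, B j) × (Fin t → ℤ))),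
    (∀ i, (a i : RootRing ξ) ∉ Ideal.span {root ξ - 1} * A i) ∧
    (∀ j, B j ≠ ⊥) ∧
    ∀ x : T,
      (∀ i, (e (f x)).1 i = extensionAction (A i) (a i) ((e x).1 i)) ∧
      (∀ j, (e (f x)).2.1 j = idealAction (B j) ((e x).2.1 j)) ∧
      (e (f x)).2.2 = (e x).2.2

/-- The `q × q` Jordan block with eigenvalue `1`: ones on the diagonal and the superdiagonal. -/
def jordanBlock (F : Type*) [Field F] (q : ℕ) : Matrix (Fin q) (Fin q) F :=
  Matrix.of fun i j => if i = j ∨ (i : ℕ) + 1 = j then 1 else 0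

/-- The endomorphism `f` of the `F`-vector space `V` has a Jordan decomposition consisting of
exactly `ℓ q` blocks of size `q` and eigenvalue `1`, for `1 ≤ q ≤ p`; that is,
`V ≃ ⨁_{q=1}^p N_q^{ℓ q}`. -/
def HasJordanBlocks {F : Type*} [Field F] {V : Type*} [AddCommGroup V] [Module F V]
    (p : ℕ) (f : V →ₗ[F] V) (ℓ : ℕ → ℕ) : Prop :=
  ∃ e : V ≃ₗ[F] (∀ q : Finset.Icc 1 p, Fin (ℓ q) → Fin q → F),
    ∀ (x : V) (q : Finset.Icc 1 p) (k : Fin (ℓ q)),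
      e (f x) q k = (jordanBlock F q).mulVec (e x q k)

end CurtisReiner

/-!
Write `O = ℤ[ξ]`, a Dedekind domain, and `π = ξ - 1`. The polynomial `1 + X + ⋯ + X ^ (p - 1)` is
`(X - 1) ^ (p - 1)` modulo `p` and takes the value `p` at `1`, so `p ∣ π ^ (p - 1)` and `π ∣ p`; as
moreover `O = ℤ + π O`, the ideal `π O` is maximal with residue ring `𝔽_p`.

*Existence of a Curtis–Reiner decomposition.* The kernel `M` of the norm `1 + φ + ⋯ + φ ^ (p - 1)`
on `T` is a finitely generated torsion-free `O`-module, and the image of the norm is a free abelian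
group with trivial action. Hence `T ≃ M × ℤ^n` with `φ (x, y) = (ξ x + h y, y)` for a linear map
`h : ℤ^n → M` (`exists_hasDecomposition`). If every value `h e_i` lies in `π M`, then `h` is a
coboundary and `T ≃ M × ℤ^n` with diagonal action; a finitely generated torsion-free module over a
Dedekind domain is a direct sum of ideals (`exists_equiv_pi_ideal`). Otherwise some `v = h e_i` is
not in `π M`. The saturation `A` of `O v` is a direct summand of `M` isomorphic to an ideal
(`exists_equiv_ideal_prod`), and every element of `A` is an integer multiple of `v` modulo `π A`
(`exists_int_smul_add`). So the components along `A` of the other values of `h` can be removed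
by changing the complement, which splits `(A, v)` off `T`
(`exists_equiv_extensionAction_prod`), and induction on `n` applies.

*Jordan blocks of a decomposition.* If `b ∈ A` is not in `π A`, then `b, π b, …, π ^ (p - 2) b`
generate `A` modulo `p`, by the same statement on integer multiples. As `A` has rank `p - 1`, its
reduction is one Jordan block of size `p - 1`. Likewise `(0, 1), (a, 0), (π a, 0), …` generate
`(A, a)` modulo `p`, whose reduction is one block of size `p`. Therefore a decomposition of type
`(r, s, t)` yields `r` blocks of size `p`, `s` of size `p - 1` and `t` of size `1`
(`HasDecomposition.isJordanFamily`); in particular a Jordan decomposition exists.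

*Comparison.* The number of blocks of size `q` is the second difference in `k` of the dimension of
`ker (φ - 1) ^ k`, so it does not depend on the Jordan decomposition (`IsJordanFamily.card_eq`).
The rank of `T` is the sum of the block sizes. The invariants are computed on each summand: an
ideal contributes rank `0`, and `(A, a)` contributes rank `1`, the fixed vectors projecting onto a
nonzero subgroup of `ℤ` because `π ∣ p` (`HasDecomposition.finrank_ker`).
-/

namespace CurtisReiner

universe u

open TensorProduct

/-! ### The ring `ℤ[ξ]` -/

theorem exists_ne_nsmul (L : Type*) [AddCommGroup L] [Module.Free ℤ L] [Nontrivial L] {q : ℕ}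
    (hq : 1 < q) : ∃ x : L, ∀ y, x ≠ q • y := by
  let b := Module.Free.chooseBasis ℤ L
  have : Nonempty (Module.Free.ChooseBasisIndex ℤ L) := b.index_nonempty
  obtain ⟨i⟩ := this
  refine ⟨b i, fun y hy => ?_⟩
  have := congrArg (fun z => b.repr z i) hy
  simp only [Module.Basis.repr_self, Finsupp.single_eq_same, map_nsmul, Finsupp.smul_apply,
    nsmul_eq_mul] at this
  have h2 := Int.eq_one_or_neg_one_of_mul_eq_one this.symm
  omega

section RootRing
variable {K : Type*} [Field K] {p : ℕ} {ξ : K}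

/-- A shortcut for instance search, which is slow at finding the structure of a subalgebra. -/
instance instModuleIdeal (A : Ideal (RootRing ξ)) : Module (RootRing ξ) A := A.module

theorem isIntegral_of_isPrimitiveRoot [Fact p.Prime] (hξ : IsPrimitiveRoot ξ p) : IsIntegral ℤ ξ :=
  hξ.isIntegral (Fact.out : p.Prime).pos

theorem isDedekindDomain_rootRing [Fact p.Prime] [CharZero K] [IsCyclotomicExtension {p} ℚ K]
    (hξ : IsPrimitiveRoot ξ p) : IsDedekindDomain (RootRing ξ) := by
  have := IsCyclotomicExtension.Rat.isIntegralClosure_adjoin_singleton_of_prime hξ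
  have : FiniteDimensional ℚ K := IsCyclotomicExtension.finiteDimensional {p} ℚ K
  exact IsIntegralClosure.isDedekindDomain ℤ ℚ K (RootRing ξ)

theorem finite_rootRing [Fact p.Prime] (hξ : IsPrimitiveRoot ξ p) :
    Module.Finite ℤ (RootRing ξ) :=
  Algebra.finite_adjoin_simple_of_isIntegral (isIntegral_of_isPrimitiveRoot hξ)

theorem finrank_rootRing [Fact p.Prime] [CharZero K] (hξ : IsPrimitiveRoot ξ p) :
    Module.finrank ℤ (RootRing ξ) = p - 1 := by
  have hp : p.Prime := Fact.out
  rw [(Algebra.adjoin.powerBasis' (isIntegral_of_isPrimitiveRoot hξ)).finrank,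
    Algebra.adjoin.powerBasis'_dim, ← Polynomial.cyclotomic_eq_minpoly hξ hp.pos,
    Polynomial.natDegree_cyclotomic, Nat.totient_prime hp]

/-- The universal property `ℤ[ξ] = ℤ[X] / (1 + X + ⋯ + X ^ (p - 1))`. -/
theorem exists_algHom_rootRing [Fact p.Prime] [CharZero K] (hξ : IsPrimitiveRoot ξ p)
    {S : Type*} [Ring S] [Algebra ℤ S] (g : S) (hg : ∑ i ∈ Finset.range p, g ^ i = 0) :
    ∃ F : RootRing ξ →ₐ[ℤ] S, F (root ξ) = g := by
  have hp : p.Prime := Fact.out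
  let B := Algebra.adjoin.powerBasis' (isIntegral_of_isPrimitiveRoot hξ)
  have hgen : B.gen = root ξ := Algebra.adjoin.powerBasis'_gen _
  have h : Polynomial.aeval g (minpoly ℤ B.gen) = 0 := by
    have : minpoly ℤ B.gen = minpoly ℤ ξ := by
      rw [hgen]
      exact (minpoly.algebraMap_eq (A := ℤ) (B := RootRing ξ) (B' := K)
        Subtype.val_injective (root ξ)).symm
    rw [this, ← Polynomial.cyclotomic_eq_minpoly hξ hp.pos, Polynomial.cyclotomic_prime]
    simpa using hg
  exact ⟨B.lift g h, by rw [← hgen]; exact B.lift_gen g h⟩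

theorem sum_root_pow [Fact p.Prime] (hξ : IsPrimitiveRoot ξ p) :
    ∑ i ∈ Finset.range p, root ξ ^ i = 0 := by
  apply Subtype.val_injective
  have := hξ.geom_sum_eq_zero (Fact.out : p.Prime).one_lt
  simpa [root] using this

theorem root_sub_one_ne_zero [Fact p.Prime] (hξ : IsPrimitiveRoot ξ p) : root ξ - 1 ≠ 0 := by
  intro h
  have := congrArg (Subtype.val) (sub_eq_zero.1 h)
  exact hξ.ne_one (Fact.out : p.Prime).one_lt this

/-- Since `1 + X + ⋯ + X ^ (p - 1) = (X - 1) ^ (p - 1)` over `𝔽_p`. -/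
theorem prime_dvd_root_sub_one_pow [Fact p.Prime] (hξ : IsPrimitiveRoot ξ p) :
    (p : RootRing ξ) ∣ (root ξ - 1) ^ (p - 1) := by
  have hp : p.Prime := Fact.out
  have h : ((Polynomial.X - 1) ^ (p - 1) - ∑ i ∈ Finset.range p, Polynomial.X ^ i :
      Polynomial ℤ).map (Int.castRingHom (ZMod p)) = 0 := by
    have h1 : (Polynomial.X - 1 : Polynomial (ZMod p)) ≠ 0 := Polynomial.X_sub_C_ne_zero 1
    apply mul_right_cancel₀ h1
    have h2 := geom_sum_mul (Polynomial.X : Polynomial (ZMod p)) p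
    simp only [Polynomial.map_sub, Polynomial.map_pow, Polynomial.map_X, Polynomial.map_one,
      Polynomial.map_sum, sub_mul, h2, ← pow_succ, Nat.sub_add_cancel hp.one_le, zero_mul]
    rw [sub_pow_char, one_pow, sub_self]
  have hdvd : Polynomial.C (p : ℤ) ∣ (Polynomial.X - 1) ^ (p - 1) -
      ∑ i ∈ Finset.range p, Polynomial.X ^ i := by
    rw [Polynomial.C_dvd_iff_dvd_coeff]
    intro i
    have := congrArg (fun q => Polynomial.coeff q i) h
    rw [Polynomial.coeff_map, Polynomial.coeff_zero] at this
    exact (ZMod.intCast_zmod_eq_zero_iff_dvd _ p).1 this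
  have := map_dvd (Polynomial.aeval (root ξ)) hdvd
  simpa [sum_root_pow hξ] using this

/-- Each term of `1 + ξ + ⋯ + ξ ^ (p - 1) = 0` is `1` modulo `ξ - 1`. -/
theorem root_sub_one_dvd_prime [Fact p.Prime] (hξ : IsPrimitiveRoot ξ p) :
    root ξ - 1 ∣ (p : RootRing ξ) := by
  have h := sum_root_pow hξ
  have h2 : root ξ - 1 ∣ ∑ i ∈ Finset.range p, (root ξ ^ i - 1) :=
    Finset.dvd_sum fun i _ => by simpa using sub_dvd_pow_sub_pow (root ξ) 1 i
  rw [Finset.sum_sub_distrib, h] at h2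
  simpa using h2

theorem exists_int_add_root_sub_one_mul (x : RootRing ξ) :
    ∃ (n : ℤ) (y : RootRing ξ), x = n + (root ξ - 1) * y := by
  obtain ⟨x, hx⟩ := x
  induction hx using Algebra.adjoin_induction with
  | mem x hx =>
    obtain rfl := hx
    exact ⟨1, 1, by simp [root]⟩
  | algebraMap r => exact ⟨r, 0, by simp; rfl⟩
  | add x y hx hy h1 h2 =>
    obtain ⟨n, a, h1⟩ := h1
    obtain ⟨m, b, h2⟩ := h2
    refine ⟨n + m, a + b, ?_⟩
    change (⟨x, hx⟩ : RootRing ξ) + ⟨y, hy⟩ = _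
    rw [h1, h2]; push_cast; ring
  | mul x y hx hy h1 h2 =>
    obtain ⟨n, a, h1⟩ := h1
    obtain ⟨m, b, h2⟩ := h2
    refine ⟨n * m, n * b + a * m + (root ξ - 1) * a * b, ?_⟩
    change (⟨x, hx⟩ : RootRing ξ) * ⟨y, hy⟩ = _
    rw [h1, h2]; push_cast; ring

/-- The quotient by `ξ - 1` is a quotient of `𝔽_p`, and it is nonzero because `ξ - 1` is not a
unit: otherwise `p`, a divisor of a power of `ξ - 1`, would be a unit of the lattice `ℤ[ξ]`. -/
theorem isMaximal_span_root_sub_one [Fact p.Prime] [CharZero K] (hξ : IsPrimitiveRoot ξ p) :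
    (Ideal.span {root ξ - 1}).IsMaximal := by
  have hp : p.Prime := Fact.out
  rw [Ideal.isMaximal_iff]
  constructor
  · intro h
    have hu : IsUnit (p : RootRing ξ) := by
      have : IsUnit (root ξ - 1) := isUnit_of_dvd_one (Ideal.mem_span_singleton.1 h)
      exact isUnit_of_dvd_unit (prime_dvd_root_sub_one_pow hξ) (this.pow _)
    have := finite_rootRing hξ
    have : Module.Free ℤ (RootRing ξ) := inferInstance
    obtain ⟨x, hx⟩ := exists_ne_nsmul (RootRing ξ) hp.one_lt
    obtain ⟨y, hy⟩ := hu.dvd (a := x)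
    exact hx y (by rw [hy, nsmul_eq_mul])
  · intro J x hJ hx hxJ
    obtain ⟨n, y, rfl⟩ := exists_int_add_root_sub_one_mul x
    have hn : ¬ (p : ℤ) ∣ n := by
      rintro ⟨m, rfl⟩
      apply hx
      refine Ideal.add_mem _ ?_ (Ideal.mul_mem_right _ _ (Ideal.mem_span_singleton_self _))
      rw [Ideal.mem_span_singleton]
      push_cast
      exact (root_sub_one_dvd_prime hξ).mul_right _
    have hpJ : (p : RootRing ξ) ∈ J :=
      hJ (Ideal.mem_span_singleton.2 (root_sub_one_dvd_prime hξ))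
    have hnJ : (n : RootRing ξ) ∈ J := by
      have := J.sub_mem hxJ (J.mul_mem_right y (hJ (Ideal.mem_span_singleton_self _)))
      simpa using this
    obtain ⟨a, b, hab⟩ := (Prime.coprime_iff_not_dvd (Nat.prime_iff_prime_int.1 hp)).2 hn
    have : (1 : RootRing ξ) = a * p + b * n := by exact_mod_cast congrArg (Int.cast) hab.symm
    rw [this]
    exact J.add_mem (J.mul_mem_left _ hpJ) (J.mul_mem_left _ hnJ)

end RootRing

/-! ### Torsion-free modules over a Dedekind domain -/

theorem projective_of_isTorsionFree {R : Type*} [CommRing R] [IsDedekindDomain R] (M : Type*)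
    [AddCommGroup M] [Module R M] [Module.Finite R M] [Module.IsTorsionFree R M] :
    Module.Projective R M := by
  have : Module.Flat R M := inferInstance
  have : Module.FinitePresentation R M := Module.finitePresentation_of_finite R M
  exact Module.Flat.projective_of_finitePresentation

/-- A finitely generated torsion-free module over a Dedekind domain splits off the saturation of
the line through a nonzero vector `v`, and this saturation is isomorphic to an ideal. -/
theorem exists_equiv_ideal_prod {R : Type*} [CommRing R] [IsDedekindDomain R] {M : Type u}
    [AddCommGroup M] [Module R M] [Module.Finite R M] [Module.IsTorsionFree R M] {v : M}
    (hv : v ≠ 0) :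
    ∃ (I : Ideal R) (M' : Type u) (_ : AddCommGroup M') (_ : Module R M')
      (_ : Module.Finite R M') (_ : Module.IsTorsionFree R M') (e : M ≃ₗ[R] I × M'),
      (e v).2 = 0 := by
  -- The kernel of `q` is the saturation of `R v`, and the target of `q` is torsion-free.
  let N := M ⧸ Submodule.span R {v}
  let Q := N ⧸ Submodule.torsion R N
  let q : M →ₗ[R] Q := (Submodule.mkQ _).comp (Submodule.mkQ _)
  have hq : Function.Surjective q :=
    (Submodule.mkQ_surjective _).comp (Submodule.mkQ_surjective _)
  have hker : ∀ x, q x = 0 ↔ ∃ c : R, c ≠ 0 ∧ ∃ d : R, c • x = d • v := by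
    intro x
    change Submodule.mkQ _ (Submodule.mkQ _ x) = 0 ↔ _
    rw [Submodule.mkQ_apply, Submodule.Quotient.mk_eq_zero, Submodule.mem_torsion_iff]
    constructor
    · rintro ⟨c, hc⟩
      refine ⟨c, nonZeroDivisors.coe_ne_zero c, ?_⟩
      have : (Submodule.span R {v}).mkQ ((c : R) • x) = 0 := by rw [map_smul]; exact hc
      rw [Submodule.mkQ_apply, Submodule.Quotient.mk_eq_zero, Submodule.mem_span_singleton] at this
      obtain ⟨d, hd⟩ := this
      exact ⟨d, hd.symm⟩
    · rintro ⟨c, hc, d, hd⟩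
      refine ⟨⟨c, mem_nonZeroDivisors_of_ne_zero hc⟩, ?_⟩
      change c • (Submodule.span R {v}).mkQ x = 0
      rw [← map_smul, Submodule.mkQ_apply, Submodule.Quotient.mk_eq_zero,
        Submodule.mem_span_singleton]
      exact ⟨d, hd.symm⟩
  have hqv : q v = 0 := (hker v).2 ⟨1, one_ne_zero, 1, rfl⟩
  have := projective_of_isTorsionFree (R := R) M
  have := projective_of_isTorsionFree (R := R) Q
  obtain ⟨σ, hσ⟩ := Module.projective_lifting_property q LinearMap.id hq
  have hσ' : ∀ y, q (σ y) = y := fun y => LinearMap.congr_fun hσ y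
  -- A functional which does not vanish at `v` embeds the saturation of `R v` into `R`.
  obtain ⟨ψ, hψ⟩ := Module.Projective.exists_dual_ne_zero R hv
  have hinj : Function.Injective (ψ.domRestrict (LinearMap.ker q)) := by
    rw [← LinearMap.ker_eq_bot, LinearMap.ker_eq_bot']
    rintro ⟨x, hx⟩ h
    obtain ⟨c, hc, d, hd⟩ := (hker x).1 hx
    have h0 : ψ x = 0 := h
    have h1 : d * ψ v = 0 := by rw [← smul_eq_mul, ← map_smul, ← hd, map_smul, h0, smul_zero]
    have hd0 : d = 0 := (mul_eq_zero.1 h1).resolve_right hψ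
    rw [hd0, zero_smul] at hd
    exact Subtype.ext ((smul_eq_zero.1 hd).resolve_left hc)
  let e₁ := LinearEquiv.ofInjective _ hinj
  let P : M →ₗ[R] LinearMap.ker q := LinearMap.codRestrict _ (LinearMap.id - σ.comp q) (by
    intro x; simp [hσ'])
  let e₂ : M ≃ₗ[R] LinearMap.ker q × Q := LinearEquiv.ofLinearMap (P.prod q)
    ((Submodule.subtype _).coprod σ)
    (by
      ext x <;> simp [P, hσ'])
    (by ext x; simp [P])
  exact ⟨_, Q, inferInstance, inferInstance, inferInstance, inferInstance,
    e₂.trans (e₁.prodCongr (LinearEquiv.refl R Q)), hqv⟩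

/-- Steinitz: a finitely generated torsion-free module over a Dedekind domain is a direct sum of
ideals. -/
theorem exists_equiv_pi_ideal {R : Type*} [CommRing R] [IsDedekindDomain R] (M : Type u)
    [AddCommGroup M] [Module R M] [Module.Finite R M] [Module.IsTorsionFree R M] :
    ∃ (s : ℕ) (B : Fin s → Ideal R), (∀ j, B j ≠ ⊥) ∧ Nonempty (M ≃ₗ[R] ∀ j, B j) := by
  induction hn : Module.finrank R M using Nat.strong_induction_on generalizing M with
  | _ n ih =>
  cases subsingleton_or_nontrivial M with
  | inl hM =>
    exact ⟨0, Fin.elim0, fun j => j.elim0, ⟨0, 0, fun x => Subsingleton.elim _ _,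
      fun x => funext fun j => j.elim0⟩⟩
  | inr hM =>
    obtain ⟨v, hv⟩ := exists_ne (0 : M)
    obtain ⟨I, M', _, _, _, _, e, he⟩ := exists_equiv_ideal_prod (R := R) hv
    have hI : I ≠ ⊥ := by
      rintro rfl
      apply hv
      apply e.injective
      rw [map_zero]
      exact Prod.ext (Subsingleton.elim _ _) he
    have hlt : Module.finrank R M' < n := by
      let q : M →ₗ[R] M' := (LinearMap.snd R I M').comp e.toLinearMap
      have hq : Function.Surjective q := Prod.snd_surjective.comp e.surjective
      have h1 := (LinearMap.ker q).finrank_quotient_add_finrank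
      rw [(q.quotKerEquivOfSurjective hq).finrank_eq, hn] at h1
      have : Nontrivial (LinearMap.ker q) :=
        ⟨⟨v, he⟩, 0, fun h => hv (congrArg Subtype.val h)⟩
      have h2 : 0 < Module.finrank R (LinearMap.ker q) := Module.finrank_pos
      omega
    obtain ⟨s, B, hB, ⟨e'⟩⟩ := ih _ hlt M' rfl
    refine ⟨s + 1, Fin.cons I B, Fin.cases hI hB, ⟨?_⟩⟩
    exact e.trans (((LinearEquiv.refl R I).prodCongr e').trans
      (Fin.consLinearEquiv R (fun j => ((Fin.cons I B : Fin (s + 1) → Ideal R) j))))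

/-! ### Existence of Curtis–Reiner decompositions -/

section Existence
variable {K : Type*} [Field K] {p : ℕ} {ξ : K}

/-- The quotient `I / (ξ - 1) I` is one-dimensional over `𝔽_p`, hence spanned by any nonzero class:
no ideal lies strictly between `(ξ - 1) I` and `I`. -/
theorem exists_int_smul_add [Fact p.Prime] [CharZero K] [IsCyclotomicExtension {p} ℚ K]
    (hξ : IsPrimitiveRoot ξ p) {I : Ideal (RootRing ξ)} {a : RootRing ξ} (ha : a ∈ I)
    (ha' : a ∉ Ideal.span {root ξ - 1} * I) {x : RootRing ξ} (hx : x ∈ I) :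
    ∃ (c : ℤ), ∃ y ∈ I, x = c * a + (root ξ - 1) * y := by
  have := isDedekindDomain_rootRing hξ
  have hmax := isMaximal_span_root_sub_one hξ
  set P := Ideal.span {root ξ - 1} with hP
  have hI : I ≠ ⊥ := by
    rintro rfl
    exact ha' (by rw [Ideal.mem_bot.1 ha]; exact Ideal.zero_mem _)
  -- `J` lies between `P * I` and `I`; as it contains `a`, it is `I`.
  let J := Ideal.span {a} ⊔ P * I
  have hJI : J ≤ I := sup_le ((Ideal.span_singleton_le_iff_mem _).2 ha) Ideal.mul_le_right
  obtain ⟨J', hJ'⟩ := Ideal.dvd_iff_le.2 hJI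
  have hPJ : P ≤ J' := by
    have h : I * J' ∣ I * P := by
      rw [← hJ', mul_comm, Ideal.dvd_iff_le]
      exact le_sup_right
    exact Ideal.dvd_iff_le.1 ((mul_dvd_mul_iff_left hI).1 h)
  have hJ1 : J' = ⊤ := by
    by_contra hne
    rw [← hmax.eq_of_le hne hPJ] at hJ'
    apply ha'
    rw [mul_comm, ← hJ']
    exact Ideal.mem_sup_left (Ideal.mem_span_singleton_self a)
  have hxJ : x ∈ J := by rwa [hJ', hJ1, Ideal.mul_top]
  obtain ⟨b, hb, w, hw, rfl⟩ := Submodule.mem_sup.1 hxJ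
  obtain ⟨d, rfl⟩ := Ideal.mem_span_singleton'.1 hb
  obtain ⟨z, hz, rfl⟩ := Ideal.mem_span_singleton_mul.1 hw
  obtain ⟨n, y, rfl⟩ := exists_int_add_root_sub_one_mul d
  exact ⟨n, y * a + z, I.add_mem (I.mul_mem_left _ ha) hz, by ring⟩

theorem HasDecomposition.of_equiv {T T' : Type*} [AddCommGroup T] [AddCommGroup T']
    {f : T →ₗ[ℤ] T} {f' : T' →ₗ[ℤ] T'} {r s t : ℕ} (h : HasDecomposition ξ f' r s t)
    (e : T ≃ₗ[ℤ] T') (he : ∀ x, e (f x) = f' (e x)) : HasDecomposition ξ f r s t := by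
  obtain ⟨A, a, B, e', h1, h2, h3⟩ := h
  refine ⟨A, a, B, e.trans e', h1, h2, fun x => ?_⟩
  simp only [LinearEquiv.trans_apply, he]
  exact h3 _

theorem HasDecomposition.cons {T : Type*} [AddCommGroup T]
    {f : T →ₗ[ℤ] T} {r s t : ℕ} (h : HasDecomposition ξ f r s t)
    (A₀ : Ideal (RootRing ξ)) (a₀ : A₀) (ha : (a₀ : RootRing ξ) ∉ Ideal.span {root ξ - 1} * A₀) :
    HasDecomposition ξ ((extensionAction A₀ a₀).prodMap f) (r + 1) s t := by
  obtain ⟨A, a, B, e', h1, h2, h3⟩ := h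
  let A' : Fin (r + 1) → Ideal (RootRing ξ) := Fin.cons A₀ A
  let a' : ∀ i, A' i := Fin.cons a₀ a
  let e₁ : ((A₀ × ℤ) × T) ≃ₗ[ℤ] ((∀ i, A' i × ℤ) × (∀ j, B j) × (Fin t → ℤ)) :=
    ((LinearEquiv.refl ℤ (A₀ × ℤ)).prodCongr e').trans
      ((LinearEquiv.prodAssoc ℤ _ _ _).symm.trans
        ((Fin.consLinearEquiv ℤ (fun i => A' i × ℤ)).prodCongr (LinearEquiv.refl ℤ _)))
  refine ⟨A', a', B, e₁, Fin.cases ha h1, h2, fun x => ⟨fun i => ?_, (h3 x.2).2.1,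
    (h3 x.2).2.2⟩⟩
  cases i using Fin.cases with
  | zero => rfl
  | succ i => exact (h3 x.2).1 i

variable (ξ) in
/-- The automorphism `(x, y) ↦ (ξ x + h y, y)` of an extension of a trivial module `F` by the
`ℤ[ξ]`-module `M`. -/
def cocycleAction {M F : Type*} [AddCommGroup M] [Module (RootRing ξ) M] [AddCommGroup F]
    (h : F →ₗ[ℤ] M) : (M × F) →ₗ[ℤ] (M × F) :=
  LinearMap.prod
    ((DistribSMul.toLinearMap ℤ M (root ξ)).comp (LinearMap.fst ℤ M F) +
      h.comp (LinearMap.snd ℤ M F))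
    (LinearMap.snd ℤ M F)

theorem cocycleAction_apply {M F : Type*} [AddCommGroup M] [Module (RootRing ξ) M] [AddCommGroup F]
    (h : F →ₗ[ℤ] M) (x : M × F) : cocycleAction ξ h x = (root ξ • x.1 + h x.2, x.2) := rfl

theorem hasDecomposition_of_addEquiv {T : Type*} [AddCommGroup T] {f : T →ₗ[ℤ] T} {s t : ℕ}
    (B : Fin s → Ideal (RootRing ξ)) (hB : ∀ j, B j ≠ ⊥) (e : T ≃+ (∀ j, B j) × (Fin t → ℤ))
    (h₁ : ∀ x j, (e (f x)).1 j = root ξ • (e x).1 j) (h₂ : ∀ x, (e (f x)).2 = (e x).2) :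
    HasDecomposition ξ f 0 s t := by
  let A : Fin 0 → Ideal (RootRing ξ) := fun _ => ⊥
  let e' : T ≃+ (∀ i, A i × ℤ) × ((∀ j, B j) × (Fin t → ℤ)) := e.trans AddEquiv.uniqueProd.symm
  exact ⟨A, fun i => i.elim0, B, e'.toIntLinearEquiv, fun i => i.elim0, hB,
    fun x => ⟨fun i => i.elim0, h₁ x, h₂ x⟩⟩

/-- A cocycle divisible by `ξ - 1` is a coboundary. -/
theorem exists_hasDecomposition_of_forall_smul [IsDedekindDomain (RootRing ξ)] {M : Type*}
    [AddCommGroup M] [Module (RootRing ξ) M] [Module.Finite (RootRing ξ) M]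
    [Module.IsTorsionFree (RootRing ξ) M] {n : ℕ} (h : (Fin n → ℤ) →ₗ[ℤ] M)
    (hh : ∀ i, ∃ z, h (Pi.single i 1) = (root ξ - 1) • z) :
    ∃ r s t, HasDecomposition ξ (cocycleAction ξ h) r s t := by
  choose z hz using hh
  let g : (Fin n → ℤ) →ₗ[ℤ] M := Fintype.linearCombination ℤ z
  have hg : ∀ y, h y = (root ξ - 1) • g y := by
    have : h = (DistribSMul.toLinearMap ℤ M (root ξ - 1)).comp g := by
      refine LinearMap.pi_ext' fun i => LinearMap.ext_ring ?_
      simp [g, hz]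
    exact fun y => LinearMap.congr_fun this y
  obtain ⟨s, B, hB, e, he⟩ : ∃ (s : ℕ) (B : Fin s → Ideal (RootRing ξ)), (∀ j, B j ≠ ⊥) ∧
      ∃ e : M ≃+ ∀ j, B j, ∀ x j, e (root ξ • x) j = root ξ • e x j := by
    obtain ⟨s, B, hB, ⟨e⟩⟩ := exists_equiv_pi_ideal (R := RootRing ξ) M
    exact ⟨s, B, hB, e.toAddEquiv, fun x j => congrFun (e.map_smul (root ξ) x) j⟩
  -- With `h = (ξ - 1) g`, the shear along `g` makes the action diagonal.
  let e₁ : (M × (Fin n → ℤ)) ≃+ (M × (Fin n → ℤ)) :=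
    { toFun := fun x => (x.1 + g x.2, x.2)
      invFun := fun x => (x.1 - g x.2, x.2)
      left_inv := fun x => by simp
      right_inv := fun x => by simp
      map_add' := fun x y => by
        refine Prod.ext ?_ rfl
        simp only [Prod.fst_add, Prod.snd_add, map_add]
        abel }
  refine ⟨0, s, n, hasDecomposition_of_addEquiv B hB
    (e₁.trans (e.prodCongr (AddEquiv.refl _))) (fun x j => ?_) fun x => rfl⟩
  have h1 : (e₁ (cocycleAction ξ h x)).1 = root ξ • (e₁ x).1 := by
    change root ξ • x.1 + h x.2 + g x.2 = root ξ • (x.1 + g x.2)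
    rw [hg, smul_add, sub_smul, one_smul]
    abel
  exact (congrArg (fun z => e z j) h1).trans (he _ j)

/-- A basis vector whose cocycle value `v` is not divisible by `ξ - 1` splits off a summand
`(A, a)`. The values at the other basis vectors are, modulo `ξ - 1`, integer multiples of `v` along
`A`, so a change of the complement removes their components along `A`. -/
theorem exists_equiv_extensionAction_prod [Fact p.Prime] [CharZero K]
    [IsCyclotomicExtension {p} ℚ K] (hξ : IsPrimitiveRoot ξ p) {M : Type u}
    [AddCommGroup M] [Module (RootRing ξ) M] [Module.Finite (RootRing ξ) M]
    [Module.IsTorsionFree (RootRing ξ) M] {n : ℕ} (h : ℤ × (Fin n → ℤ) →ₗ[ℤ] M)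
    (hi : ∀ z, h (1, 0) ≠ (root ξ - 1) • z) :
    ∃ (A : Ideal (RootRing ξ)) (a : A) (M' : Type u) (_ : AddCommGroup M')
      (_ : Module (RootRing ξ) M') (_ : Module.Finite (RootRing ξ) M')
      (_ : Module.IsTorsionFree (RootRing ξ) M') (h' : (Fin n → ℤ) →ₗ[ℤ] M')
      (e : (M × (ℤ × (Fin n → ℤ))) ≃ₗ[ℤ] (A × ℤ) × (M' × (Fin n → ℤ))),
      (a : RootRing ξ) ∉ Ideal.span {root ξ - 1} * A ∧
      ∀ x, e (cocycleAction ξ h x) = (extensionAction A a).prodMap (cocycleAction ξ h') (e x) := by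
  have := isDedekindDomain_rootRing hξ
  have hv0 : h (1, 0) ≠ 0 := fun h0 => hi 0 (by rw [h0, smul_zero])
  obtain ⟨A, M', _, _, _, _, e', he'⟩ := exists_equiv_ideal_prod (R := RootRing ξ) hv0
  obtain ⟨e, he, hsmul₁, hsmul₂⟩ : ∃ e : M ≃+ A × M', (e (h (1, 0))).2 = 0 ∧
      (∀ (c : RootRing ξ) x, (e (c • x)).1 = c • (e x).1) ∧
      ∀ (c : RootRing ξ) x, (e (c • x)).2 = c • (e x).2 :=
    ⟨e'.toAddEquiv, he', fun c x => congrArg Prod.fst (e'.map_smul c x),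
      fun c x => congrArg Prod.snd (e'.map_smul c x)⟩
  clear he' e'
  obtain ⟨a, ha⟩ : ∃ a, a = (e (h (1, 0))).1 := ⟨_, rfl⟩
  have hmem : (a : RootRing ξ) ∉ Ideal.span {root ξ - 1} * A := by
    intro hmem
    obtain ⟨z, hz, hz'⟩ := Ideal.mem_span_singleton_mul.1 hmem
    refine hi (e.symm (⟨z, hz⟩, 0)) (e.injective (Prod.ext ?_ ?_))
    · rw [hsmul₁, AddEquiv.apply_symm_apply, ← ha]
      exact Subtype.ext hz'.symm
    · rw [hsmul₂, AddEquiv.apply_symm_apply, he, smul_zero]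
  have hex : ∀ j : Fin n, ∃ (c : ℤ) (y : A),
      (e (h (0, Pi.single j 1))).1 = c • a + (root ξ - 1) • y := by
    intro j
    obtain ⟨c, y, hy, hxy⟩ := exists_int_smul_add hξ a.2 hmem (e (h (0, Pi.single j 1))).1.2
    exact ⟨c, ⟨y, hy⟩, Subtype.ext (by simpa using hxy)⟩
  choose c y hcy using hex
  let C : (Fin n → ℤ) →ₗ[ℤ] ℤ := Fintype.linearCombination ℤ c
  let Y : (Fin n → ℤ) →ₗ[ℤ] A := Fintype.linearCombination ℤ y
  let H : (Fin n → ℤ) →ₗ[ℤ] A × M' :=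
    e.toAddMonoidHom.toIntLinearMap.comp (h.comp (LinearMap.inr ℤ ℤ (Fin n → ℤ)))
  have hCY : ∀ w, (H w).1 = C w • a + (root ξ - 1) • Y w := by
    have : (LinearMap.fst ℤ A M').comp H =
        C.smulRight a + (DistribSMul.toLinearMap ℤ A (root ξ - 1)).comp Y := by
      refine LinearMap.pi_ext' fun j => LinearMap.ext_ring ?_
      simpa [C, Y, H] using hcy j
    exact fun w => LinearMap.congr_fun this w
  let h' : (Fin n → ℤ) →ₗ[ℤ] M' := (LinearMap.snd ℤ A M').comp H
  have hval : ∀ (k : ℤ) (w : Fin n → ℤ), e (h (k, w)) = k • (a, 0) + H w := by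
    intro k w
    have : ((k, w) : ℤ × (Fin n → ℤ)) = k • (1, 0) + (0, w) := by simp
    rw [this, map_add, map_add, map_smul, map_zsmul]
    have h1 : e (h (1, 0)) = (a, 0) := Prod.ext ha.symm he
    rw [h1]
    rfl
  have hval₁ : ∀ x k w, (e (x + h (k, w))).1 = (e x).1 + (k • a + (H w).1) := by
    intro x k w
    rw [map_add, hval]
    rfl
  have hval₂ : ∀ x k w, (e (x + h (k, w))).2 = (e x).2 + (H w).2 := by
    intro x k w
    rw [map_add, hval]
    refine congrArg ((e x).2 + ·) ?_
    change k • (0 : M') + (H w).2 = (H w).2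
    rw [smul_zero, zero_add]
  have hshear : ∀ X Z W : A,
      root ξ • X + (Z + (root ξ - 1) • W) + W = root ξ • (X + W) + Z := by
    intro X Z W
    rw [smul_add, sub_smul, one_smul]
    abel
  -- The new complement is spanned by the vectors `w - C w • (1, 0) - Y w`, so `C` and `Y` are the
  -- corrections to the coordinates along `(A, a)`.
  let Θ : (M × (ℤ × (Fin n → ℤ))) ≃+ (A × ℤ) × (M' × (Fin n → ℤ)) :=
    { toFun := fun x => (((e x.1).1 + Y x.2.2, x.2.1 + C x.2.2), ((e x.1).2, x.2.2))
      invFun := fun x => (e.symm (x.1.1 - Y x.2.2, x.2.1), (x.1.2 - C x.2.2, x.2.2))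
      left_inv := fun x => by simp
      right_inv := fun x => by simp
      map_add' := fun x y => by
        refine Prod.ext (Prod.ext ?_ ?_) (Prod.ext ?_ rfl)
        · simp only [Prod.fst_add, Prod.snd_add, map_add]
          abel
        · simp only [Prod.fst_add, Prod.snd_add, map_add]
          abel
        · simp only [Prod.fst_add, Prod.snd_add, map_add] }
  refine ⟨A, a, M', inferInstance, inferInstance, inferInstance, inferInstance, h',
    Θ.toIntLinearEquiv, hmem, fun x => ?_⟩
  obtain ⟨x, k, w⟩ := x
  refine Prod.ext (Prod.ext ?_ rfl) (Prod.ext ?_ rfl)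
  · change (e (root ξ • x + h (k, w))).1 + Y w = root ξ • ((e x).1 + Y w) + (k + C w) • a
    rw [hval₁, hsmul₁, hCY, ← add_assoc (k • a), ← add_smul, hshear]
  · change (e (root ξ • x + h (k, w))).2 = root ξ • (e x).2 + (H w).2
    rw [hval₂, hsmul₂]

theorem exists_hasDecomposition_cocycleAction [Fact p.Prime] [CharZero K]
    [IsCyclotomicExtension {p} ℚ K] (hξ : IsPrimitiveRoot ξ p) (n : ℕ) (M : Type u)
    [AddCommGroup M] [Module (RootRing ξ) M] [Module.Finite (RootRing ξ) M]
    [Module.IsTorsionFree (RootRing ξ) M] (h : (Fin n → ℤ) →ₗ[ℤ] M) :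
    ∃ r s t, HasDecomposition ξ (cocycleAction ξ h) r s t := by
  have := isDedekindDomain_rootRing hξ
  induction n generalizing M with
  | zero => exact exists_hasDecomposition_of_forall_smul h fun i => i.elim0
  | succ n ih =>
    by_cases hh : ∀ i, ∃ z, h (Pi.single i 1) = (root ξ - 1) • z
    · exact exists_hasDecomposition_of_forall_smul h hh
    · push Not at hh
      obtain ⟨i, hi⟩ := hh
      -- `S` separates the `i`-th coordinate.
      let S : (Fin (n + 1) → ℤ) ≃ₗ[ℤ] ℤ × (Fin n → ℤ) := AddEquiv.toIntLinearEquiv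
        { toFun := fun y => (y i, fun j => y (i.succAbove j))
          invFun := fun y => i.insertNth y.1 y.2
          left_inv := fun y => Fin.insertNth_self_removeNth i y
          right_inv := fun y => by simp
          map_add' := fun _ _ => rfl }
      have hS : S.symm (1, 0) = Pi.single i 1 := by
        rw [LinearEquiv.symm_apply_eq]
        refine Prod.ext (Pi.single_eq_same (M := fun _ => ℤ) i 1).symm (funext fun j => ?_)
        exact (Pi.single_eq_of_ne (M := fun _ => ℤ) (Fin.succAbove_ne i j) 1).symm
      obtain ⟨A, a, M', _, _, _, _, h', e, ha, he⟩ :=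
        exists_equiv_extensionAction_prod hξ (h.comp S.symm.toLinearMap) (by simpa [hS] using hi)
      obtain ⟨r, s, t, hd⟩ := ih M' h'
      refine ⟨r + 1, s, t, (hd.cons A a ha).of_equiv
        (((LinearEquiv.refl ℤ M).prodCongr S).trans e) fun x => ?_⟩
      rw [LinearEquiv.trans_apply, LinearEquiv.trans_apply, ← he]
      simp [cocycleAction_apply]

/-- Every nonzero element of `ℤ[ξ]` divides a nonzero integer. -/
theorem isTorsionFree_rootRing [Fact p.Prime] [CharZero K] (hξ : IsPrimitiveRoot ξ p) (M : Type*)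
    [AddCommGroup M] [Module.IsTorsionFree ℤ M] [Module (RootRing ξ) M] :
    Module.IsTorsionFree (RootRing ξ) M := by
  have := finite_rootRing hξ
  refine Module.IsTorsionFree.of_smul_eq_zero fun x m hxm => or_iff_not_imp_left.2 fun hx => ?_
  obtain ⟨n, hn, y, hy⟩ := (Algebra.IsIntegral.isIntegral (R := ℤ) x).isAlgebraic.exists_nonzero_dvd
    (mem_nonZeroDivisors_of_ne_zero hx)
  have : n • m = 0 := by
    rw [← algebraMap_smul (RootRing ξ) n m, hy, mul_comm, mul_smul, hxm, smul_zero]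
  exact (smul_eq_zero.1 this).resolve_left hn

/-- The kernel of the norm `1 + f + ⋯ + f ^ (p - 1)` is a `ℤ[ξ]`-module and the image of the norm
is a trivial module, so `T` is an extension given by a cocycle. -/
theorem exists_hasDecomposition [Fact p.Prime] [CharZero K]
    [IsCyclotomicExtension {p} ℚ K] (hξ : IsPrimitiveRoot ξ p) {T : Type*} [AddCommGroup T]
    [Module.Free ℤ T] [Module.Finite ℤ T] (f : T →ₗ[ℤ] T) (hf : f ^ p = 1) :
    ∃ r s t, HasDecomposition ξ f r s t := by
  let N : T →ₗ[ℤ] T := ∑ i ∈ Finset.range p, f ^ i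
  have hNf : N * (f - 1) = 0 := by rw [geom_sum_mul, hf, sub_self]
  have hfN : (f - 1) * N = 0 := by rw [mul_geom_sum, hf, sub_self]
  have hNfx : ∀ x, N (f x) = N x := fun x => by
    have := LinearMap.congr_fun hNf x
    simpa [sub_eq_zero] using this
  let M := LinearMap.ker N
  let g : Module.End ℤ M := f.restrict (p := M) (q := M) fun x hx => by
    rw [LinearMap.mem_ker, hNfx]; exact hx
  have hg : ∑ i ∈ Finset.range p, g ^ i = 0 := by
    ext x
    have hpow : ∀ i : ℕ, (((g ^ i) x : M) : T) = (f ^ i) x := by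
      intro i
      induction i with
      | zero => rfl
      | succ i ih =>
        rw [pow_succ', pow_succ', Module.End.mul_apply, Module.End.mul_apply, ← ih]
        rfl
    have hx : N x = 0 := x.2
    rw [LinearMap.sum_apply] at hx
    simpa [LinearMap.sum_apply, hpow] using hx
  obtain ⟨F, hF⟩ := exists_algHom_rootRing hξ g hg
  let _ : Module (RootRing ξ) M := Module.compHom M F.toRingHom
  have hroot : ∀ x : M, ((root ξ • x : M) : T) = f x := fun x => by
    change ((F (root ξ) x : M) : T) = f x
    rw [hF]
    rfl
  have : Module.IsTorsionFree (RootRing ξ) M := isTorsionFree_rootRing hξ M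
  have : Module.Finite (RootRing ξ) M := Module.Finite.of_restrictScalars_finite ℤ _ _
  let b := Module.finBasis ℤ (LinearMap.range N)
  set n := Module.finrank ℤ (LinearMap.range N)
  let q : T →ₗ[ℤ] (Fin n → ℤ) := b.equivFun.toLinearMap.comp N.rangeRestrict
  have hq : Function.Surjective q := b.equivFun.surjective.comp N.surjective_rangeRestrict
  have hqf : ∀ x, q (f x) = q x := fun x =>
    congrArg b.equivFun (Subtype.ext (hNfx x))
  have hq0 : ∀ x, x ∈ M ↔ q x = 0 := fun x => by
    change N x = 0 ↔ b.equivFun (N.rangeRestrict x) = 0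
    rw [LinearEquiv.map_eq_zero_iff, ← Subtype.coe_inj]
    rfl
  -- For an additive section `σ` of `q`, the defect of equivariance is the cocycle `h`.
  obtain ⟨σ, hσ⟩ := Module.projective_lifting_property q LinearMap.id hq
  have hσ' : ∀ y, q (σ y) = y := fun y => LinearMap.congr_fun hσ y
  let h : (Fin n → ℤ) →ₗ[ℤ] M := LinearMap.codRestrict M ((f - 1).comp σ) fun y => by
    rw [hq0]; simp [hqf]
  obtain ⟨r, s, t, hd⟩ := exists_hasDecomposition_cocycleAction hξ n M h
  let e : (M × (Fin n → ℤ)) ≃+ T :=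
    { toFun := fun x => x.1 + σ x.2
      invFun := fun x => (⟨x - σ (q x), by rw [hq0]; simp [hσ']⟩, q x)
      left_inv := fun x => by
        have : q (x.1 : T) = 0 := (hq0 _).1 x.1.2
        refine Prod.ext (Subtype.ext ?_) ?_ <;> simp [hσ', this]
      right_inv := fun x => by simp
      map_add' := fun x y => by simp; abel }
  refine ⟨r, s, t, hd.of_equiv e.symm.toIntLinearEquiv fun x => ?_⟩
  change e.symm (f x) = cocycleAction ξ h (e.symm x)
  rw [AddEquiv.symm_apply_eq, cocycleAction_apply]
  obtain ⟨⟨m, y⟩, rfl⟩ := e.surjective x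
  rw [AddEquiv.symm_apply_apply]
  change f (m + σ y) = ((root ξ • m : M) : T) + (f (σ y) - σ y) + σ y
  rw [hroot, map_add]
  abel

end Existence

/-! ### Reductions of lattices modulo `p` -/

/-- The endomorphism `f` of `V` is a direct sum, indexed by `ι`, of unipotent Jordan blocks of
sizes `d i`. -/
def IsJordanFamily {F V : Type*} [Field F] [AddCommGroup V] [Module F V] (f : V →ₗ[F] V)
    {ι : Type*} (d : ι → ℕ) : Prop :=
  ∃ e : V ≃ₗ[F] (∀ i, Fin (d i) → F), ∀ x i, e (f x) i = (jordanBlock F (d i)).mulVec (e x i)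

/-- The reduction modulo `p` of the endomorphism `f` of the lattice `L` is a direct sum, indexed by
`ι`, of unipotent Jordan blocks of sizes `d i`. The reduction is encoded by a surjection of `L`
whose kernel is contained in `p L`, hence equal to it. -/
def IsJordanReduction (p : ℕ) [Fact p.Prime] {L : Type*} [AddCommGroup L] (f : L →ₗ[ℤ] L)
    {ι : Type*} (d : ι → ℕ) : Prop :=
  ∃ F : L →+ (∀ i, Fin (d i) → ZMod p), Function.Surjective F ∧
    (∀ x, F x = 0 → ∃ y, x = p • y) ∧
    ∀ x i, F (f x) i = (jordanBlock (ZMod p) (d i)).mulVec (F x i)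

section Reduction
variable {p : ℕ} [Fact p.Prime]

theorem exists_one_tmul_eq {L : Type*} [AddCommGroup L] (z : ZMod p ⊗[ℤ] L) :
    ∃ x : L, z = 1 ⊗ₜ x := by
  induction z with
  | zero => exact ⟨0, (tmul_zero _ _).symm⟩
  | tmul c x =>
    obtain ⟨n, rfl⟩ := ZMod.intCast_surjective c
    refine ⟨n • x, ?_⟩
    rw [tmul_smul, smul_tmul', zsmul_one]
  | add z w hz hw =>
    obtain ⟨x, rfl⟩ := hz
    obtain ⟨y, rfl⟩ := hw
    exact ⟨x + y, (tmul_add _ _ _).symm⟩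

theorem one_tmul_nsmul {L : Type*} [AddCommGroup L] (x : L) :
    (1 : ZMod p) ⊗ₜ[ℤ] (p • x) = 0 := by
  rw [tmul_smul, smul_tmul', nsmul_one, ZMod.natCast_self, zero_tmul]

theorem exists_eq_nsmul_of_one_tmul_eq_zero {L : Type*} [AddCommGroup L] [Module.Free ℤ L]
    {x : L} (hx : (1 : ZMod p) ⊗ₜ[ℤ] x = 0) : ∃ y, x = p • y := by
  let b := Module.Free.chooseBasis ℤ L
  have h : ∀ i, (p : ℤ) ∣ b.repr x i := by
    intro i
    have := congrArg (fun z => (b.baseChange (ZMod p)).repr z i) hx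
    simp only [Module.Basis.baseChange_repr_tmul, map_zero, Finsupp.zero_apply] at this
    rw [← ZMod.intCast_zmod_eq_zero_iff_dvd, ← zsmul_one]
    exact this
  choose c hc using h
  refine ⟨∑ i ∈ (b.repr x).support, c i • b i, ?_⟩
  conv_lhs => rw [← b.linearCombination_repr x, Finsupp.linearCombination_apply, Finsupp.sum]
  rw [Finset.smul_sum]
  refine Finset.sum_congr rfl fun i _ => ?_
  rw [hc i, mul_smul, natCast_zsmul]

theorem IsJordanReduction.isJordanFamily {L : Type*} [AddCommGroup L] {f : L →ₗ[ℤ] L} {ι : Type*}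
    {d : ι → ℕ} (h : IsJordanReduction p f d) : IsJordanFamily (f.baseChange (ZMod p)) d := by
  obtain ⟨F, hF, hker, hf⟩ := h
  let Φ : ZMod p ⊗[ℤ] L →ₗ[ZMod p] (∀ i, Fin (d i) → ZMod p) :=
    F.toIntLinearMap.liftBaseChange (ZMod p)
  have hΦ : ∀ x, Φ (1 ⊗ₜ x) = F x := fun x => by simp [Φ]
  have hbij : Function.Bijective Φ := by
    constructor
    · rw [← LinearMap.ker_eq_bot, LinearMap.ker_eq_bot']
      intro z hz
      obtain ⟨x, rfl⟩ := exists_one_tmul_eq z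
      rw [hΦ] at hz
      obtain ⟨y, rfl⟩ := hker x hz
      exact one_tmul_nsmul y
    · intro w
      obtain ⟨x, rfl⟩ := hF w
      exact ⟨_, hΦ x⟩
  refine ⟨LinearEquiv.ofBijective Φ hbij, fun z i => ?_⟩
  obtain ⟨x, rfl⟩ := exists_one_tmul_eq z
  simp only [LinearEquiv.ofBijective_apply, LinearMap.baseChange_tmul, hΦ, hf]

theorem IsJordanReduction.of_equiv {L L' : Type*} [AddCommGroup L] [AddCommGroup L']
    {f : L →ₗ[ℤ] L} {f' : L' →ₗ[ℤ] L'} {ι : Type*} {d : ι → ℕ} (h : IsJordanReduction p f' d)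
    (e : L ≃+ L') (he : ∀ x, e (f x) = f' (e x)) : IsJordanReduction p f d := by
  obtain ⟨F, hF, hker, hf⟩ := h
  refine ⟨F.comp e.toAddMonoidHom, hF.comp e.surjective, fun x hx => ?_, fun x i => ?_⟩
  · obtain ⟨y, hy⟩ := hker (e x) hx
    exact ⟨e.symm y, by rw [← map_nsmul, ← hy, AddEquiv.symm_apply_apply]⟩
  · change F (e (f x)) i = (jordanBlock (ZMod p) (d i)).mulVec (F (e x) i)
    rw [he, hf]

theorem IsJordanReduction.prod {L L' : Type*} [AddCommGroup L] [AddCommGroup L']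
    {f : L →ₗ[ℤ] L} {f' : L' →ₗ[ℤ] L'} {ι ι' : Type*} {d : ι → ℕ} {d' : ι' → ℕ}
    (h : IsJordanReduction p f d) (h' : IsJordanReduction p f' d') :
    IsJordanReduction p (f.prodMap f') (Sum.elim d d') := by
  obtain ⟨F, hF, hker, hf⟩ := h
  obtain ⟨F', hF', hker', hf'⟩ := h'
  let Φ : L × L' →+ (∀ i, Fin (Sum.elim d d' i) → ZMod p) :=
    { toFun := fun x i => match i with
        | Sum.inl i => F x.1 i
        | Sum.inr i => F' x.2 i
      map_zero' := by
        funext i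
        cases i
        · exact congrFun (map_zero F) _
        · exact congrFun (map_zero F') _
      map_add' := fun x y => by
        funext i
        cases i
        · exact congrFun (map_add F x.1 y.1) _
        · exact congrFun (map_add F' x.2 y.2) _ }
  refine ⟨Φ, fun w => ?_, fun x hx => ?_, fun x i => ?_⟩
  · obtain ⟨x, hx⟩ := hF fun i => w (Sum.inl i)
    obtain ⟨y, hy⟩ := hF' fun i => w (Sum.inr i)
    refine ⟨(x, y), funext fun i => ?_⟩
    cases i
    · exact congrFun hx _
    · exact congrFun hy _
  · obtain ⟨y, hy⟩ := hker x.1 (funext fun i => congrFun hx (Sum.inl i))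
    obtain ⟨y', hy'⟩ := hker' x.2 (funext fun i => congrFun hx (Sum.inr i))
    exact ⟨(y, y'), Prod.ext hy hy'⟩
  · cases i
    · exact hf x.1 _
    · exact hf' x.2 _

/-- A product of lattices whose reductions are single blocks, each written as a family over `Unit`,
reduces to the family of these blocks. -/
theorem IsJordanReduction.pi {ι : Type*} {L : ι → Type*} [∀ i, AddCommGroup (L i)]
    {f : (∀ i, L i) →ₗ[ℤ] (∀ i, L i)} (g : ∀ i, L i →ₗ[ℤ] L i) (hg : ∀ x i, f x i = g i (x i))
    {d : ι → ℕ} (h : ∀ i, IsJordanReduction p (g i) fun _ : Unit => d i) :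
    IsJordanReduction p f d := by
  choose F hF hker hf using h
  let Φ : (∀ i, L i) →+ (∀ i, Fin (d i) → ZMod p) :=
    { toFun := fun x i => F i (x i) ()
      map_zero' := funext fun i => congrFun (map_zero (F i)) ()
      map_add' := fun x y => funext fun i => congrFun (map_add (F i) (x i) (y i)) () }
  refine ⟨Φ, fun w => ?_, fun x hx => ?_, fun x i => ?_⟩
  · choose x hx using fun i => hF i fun _ => w i
    exact ⟨x, funext fun i => congrFun (hx i) ()⟩
  · choose y hy using fun i => hker i (x i) (funext fun _ => congrFun hx i)
    exact ⟨y, funext hy⟩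
  · change F i (f x i) () = _
    rw [hg]
    exact hf i (x i) ()

/-- A lattice of rank `q` whose reduction is generated, as a module over the polynomials in the
nilpotent `f - 1`, by one vector `v`. -/
theorem isJordanReduction_of_cyclic {L : Type*} [AddCommGroup L] [Module.Free ℤ L]
    [Module.Finite ℤ L] (f : Module.End ℤ L) {q : ℕ} (hq : Module.finrank ℤ L = q) (v : L)
    (hspan : ∀ x, ∃ (c : ℕ → ℤ) (y : L), x = ∑ i ∈ Finset.range q, c i • ((f - 1) ^ i) v + p • y)
    (hnil : ∃ y, ((f - 1) ^ q) v = p • y) : IsJordanReduction p f fun _ : Unit => q := by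
  -- The block is upper triangular, so the generator `v` is the last basis vector.
  let u : Fin q → ZMod p ⊗[ℤ] L := fun j => 1 ⊗ₜ ((f - 1) ^ (q - 1 - j)) v
  have htop : ⊤ ≤ Submodule.span (ZMod p) (Set.range u) := by
    rintro z -
    obtain ⟨x, rfl⟩ := exists_one_tmul_eq z
    obtain ⟨c, y, rfl⟩ := hspan x
    rw [tmul_add, one_tmul_nsmul, add_zero, tmul_sum]
    refine Submodule.sum_mem _ fun i hi => ?_
    rw [Finset.mem_range] at hi
    rw [tmul_smul]
    have hu : u ⟨q - 1 - i, by omega⟩ = 1 ⊗ₜ ((f - 1) ^ i) v := by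
      simp only [u]
      congr 3
      omega
    rw [← hu]
    exact zsmul_mem (Submodule.subset_span (Set.mem_range_self _)) _
  let B := basisOfTopLeSpanOfCardEqFinrank u htop (by
    rw [Fintype.card_fin, Module.finrank_baseChange, hq])
  have hB : ⇑B = u := coe_basisOfTopLeSpanOfCardEqFinrank u htop _
  have hfu : ∀ j : Fin q, f.baseChange (ZMod p) (u j) =
      u j + ∑ i : Fin q, if (i : ℕ) + 1 = j then u i else 0 := by
    intro j
    have h1 : f.baseChange (ZMod p) (u j) = u j + 1 ⊗ₜ ((f - 1) ^ (q - 1 - j + 1)) v := by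
      simp only [u, LinearMap.baseChange_tmul, ← tmul_add, pow_succ', Module.End.mul_apply]
      simp
    rw [h1]
    congr 1
    obtain ⟨j, hj⟩ := j
    cases j with
    | zero =>
      obtain ⟨y, hy⟩ := hnil
      have : q - 1 + 1 = q := by omega
      simp only [Nat.sub_zero, this, hy, one_tmul_nsmul, Nat.succ_ne_zero, if_false,
        Finset.sum_const_zero]
    | succ j =>
      rw [Finset.sum_eq_single_of_mem ⟨j, by omega⟩ (Finset.mem_univ _)]
      · simp only [if_true, u]
        congr 3
        omega
      · intro b _ hb
        rw [if_neg]
        simpa [Fin.ext_iff] using hb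
  have hlin : B.equivFun.toLinearMap ∘ₗ f.baseChange (ZMod p) =
      (jordanBlock (ZMod p) q).mulVecLin ∘ₗ B.equivFun.toLinearMap := by
    refine B.ext fun j => ?_
    ext k
    have h2 : ∀ i, B.equivFun (u i) = Pi.single i 1 := fun i => by
      rw [← hB]; ext k; simp [Pi.single_apply, eq_comm]
    simp only [LinearMap.comp_apply, LinearEquiv.coe_coe, hB, hfu, map_add, map_sum, h2,
      Matrix.mulVecLin_apply, Matrix.mulVec_single_one, Matrix.col_apply, jordanBlock,
      Matrix.of_apply, apply_ite B.equivFun, map_zero, Pi.add_apply, Finset.sum_apply]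
    by_cases hkj : k = j
    · subst hkj
      have : ∀ i : Fin q,
          (if (i : ℕ) + 1 = k then (Pi.single i 1 : Fin q → ZMod p) else 0) k = 0 := by
        intro i
        split_ifs with hi
        · exact Pi.single_eq_of_ne (by rintro rfl; omega) _
        · rfl
      simp [this]
    · rw [Pi.single_eq_of_ne hkj, zero_add, Finset.sum_eq_single_of_mem k (Finset.mem_univ _)]
      · simp [hkj]
        split_ifs <;> simp
      · intro i _ hik
        split_ifs
        · exact Pi.single_eq_of_ne hik.symm _
        · rfl
  let F : L →+ (Unit → Fin q → ZMod p) :=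
    { toFun := fun x _ => B.equivFun (1 ⊗ₜ x)
      map_zero' := by simp; rfl
      map_add' := fun x y => by rw [tmul_add, map_add]; rfl }
  refine ⟨F, fun w => ?_, fun x hx => ?_, fun x i => ?_⟩
  · obtain ⟨x, hx⟩ := exists_one_tmul_eq (B.equivFun.symm (w ()))
    refine ⟨x, funext fun i => ?_⟩
    change B.equivFun (1 ⊗ₜ x) = w i
    rw [← hx, LinearEquiv.apply_symm_apply]
  · exact exists_eq_nsmul_of_one_tmul_eq_zero ((LinearEquiv.map_eq_zero_iff _).1 (congrFun hx ()))
  · exact LinearMap.congr_fun hlin (1 ⊗ₜ x)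

end Reduction

/-! ### Uniqueness of Jordan blocks -/

section Jordan
variable {F V : Type*} [Field F] [AddCommGroup V] [Module F V] {f : V →ₗ[F] V}

theorem IsJordanFamily.hasJordanBlocks {ι : Type*} [Fintype ι] {d : ι → ℕ} {p : ℕ}
    (h : IsJordanFamily f d) (hd : ∀ i, d i ∈ Finset.Icc 1 p) :
    HasJordanBlocks p f fun q => Fintype.card {i // d i = q} := by
  obtain ⟨e, he⟩ := h
  let ε : ∀ q, {i // d i = q} ≃ Fin (Fintype.card {i // d i = q}) := fun q => Fintype.equivFin _
  -- The blocks are regrouped by size; `Fin.cast` identifies `Fin q` with `Fin (d i)` if `d i = q`.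
  let Φ : (∀ i, Fin (d i) → F) ≃ₗ[F]
      (∀ q : Finset.Icc 1 p, Fin (Fintype.card {i // d i = (q : ℕ)}) → Fin q → F) :=
    { toFun := fun x q k j => x ((ε q).symm k).1 (Fin.cast ((ε q).symm k).2.symm j)
      invFun := fun y i => y ⟨d i, hd i⟩ (ε (d i) ⟨i, rfl⟩)
      left_inv := fun x => by
        funext i j
        have : ∀ z : {i' // d i' = d i}, z = ⟨i, rfl⟩ → x z.1 (Fin.cast z.2.symm j) = x i j := by
          rintro _ rfl
          rfl
        exact this _ (Equiv.symm_apply_apply _ _)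
      right_inv := fun y => by
        funext ⟨q, hq⟩ k j
        obtain ⟨⟨i, hi⟩, rfl⟩ := (ε q).surjective k
        subst hi
        have : ∀ z : {i' // d i' = d i}, z = ⟨i, rfl⟩ → y ⟨d z.1, hd z.1⟩ (ε (d z.1) ⟨z.1, rfl⟩)
            (Fin.cast z.2.symm j) = y ⟨d i, hq⟩ (ε (d i) ⟨i, rfl⟩) j := by
          rintro _ rfl
          rfl
        exact this _ (Equiv.symm_apply_apply _ _)
      map_add' := fun _ _ => rfl
      map_smul' := fun _ _ => rfl }
  refine ⟨e.trans Φ, fun x q k => ?_⟩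
  obtain ⟨⟨i, hi⟩, rfl⟩ := (ε q).surjective k
  obtain ⟨q, hq⟩ := q
  change d i = q at hi
  subst hi
  have : ∀ z : {i' // d i' = d i}, z = ⟨i, rfl⟩ →
      (fun j => e (f x) z.1 (Fin.cast z.2.symm j)) =
        (jordanBlock F (d i)).mulVec fun j => e x z.1 (Fin.cast z.2.symm j) := by
    rintro _ rfl
    exact he x i
  exact this _ (Equiv.symm_apply_apply _ _)

theorem HasJordanBlocks.isJordanFamily {p : ℕ} {ℓ : ℕ → ℕ} (h : HasJordanBlocks p f ℓ) :
    IsJordanFamily f fun i : (q : Finset.Icc 1 p) × Fin (ℓ q) => (i.1 : ℕ) := by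
  obtain ⟨e, he⟩ := h
  let Φ : (∀ q : Finset.Icc 1 p, Fin (ℓ q) → Fin q → F) ≃ₗ[F]
      (∀ i : (q : Finset.Icc 1 p) × Fin (ℓ q), Fin (i.1 : ℕ) → F) :=
    { toFun := fun x i => x i.1 i.2
      invFun := fun y q k => y ⟨q, k⟩
      map_add' := fun _ _ => rfl
      map_smul' := fun _ _ => rfl }
  exact ⟨e.trans Φ, fun x i => he x i.1 i.2⟩

theorem IsJordanFamily.finrank_eq {ι : Type*} [Fintype ι] {d : ι → ℕ} (h : IsJordanFamily f d) :
    Module.finrank F V = ∑ i, d i := by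
  obtain ⟨e, -⟩ := h
  rw [e.finrank_eq, Module.finrank_pi_fintype]
  simp

theorem jordanBlock_mulVec_apply {q : ℕ} (x : Fin q → F) (j : Fin q) :
    (jordanBlock F q).mulVec x j = x j + if h : (j : ℕ) + 1 < q then x ⟨j + 1, h⟩ else 0 := by
  simp only [Matrix.mulVec, dotProduct, jordanBlock, Matrix.of_apply, ite_mul, one_mul, zero_mul]
  have : ∀ i : Fin q, (if j = i ∨ (j : ℕ) + 1 = i then x i else 0) =
      (if j = i then x i else 0) + if (j : ℕ) + 1 = i then x i else 0 := by
    intro i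
    by_cases h1 : j = i
    · subst h1; simp
    · simp [h1]
  simp only [this, Finset.sum_add_distrib, Finset.sum_ite_eq, Finset.mem_univ, if_true]
  congr 1
  split_ifs with h
  · rw [Finset.sum_eq_single_of_mem ⟨j + 1, h⟩ (Finset.mem_univ _)]
    · simp
    · intro i _ hi
      rw [if_neg]
      rintro h2
      exact hi (Fin.ext h2.symm)
  · refine Finset.sum_eq_zero fun i _ => if_neg fun h2 => ?_
    omega

/-- The `k`-th power of `f - 1` shifts the coordinates of each block by `k`, so its kernel consists
of the vectors supported on the first `k` coordinates of each block. -/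
theorem IsJordanFamily.finrank_ker_pow {ι : Type*} [Fintype ι] {d : ι → ℕ}
    {f : Module.End F V} (h : IsJordanFamily f d) (k : ℕ) :
    Module.finrank F (LinearMap.ker ((f - 1) ^ k)) = ∑ i, min (d i) k := by
  obtain ⟨e, he⟩ := h
  have hpow : ∀ (k : ℕ) x i (j : Fin (d i)), e (((f - 1) ^ k) x) i j =
      if h : (j : ℕ) + k < d i then e x i ⟨j + k, h⟩ else 0 := by
    intro k
    induction k with
    | zero => intro x i j; simp
    | succ k ih =>
      intro x i j
      rw [pow_succ, Module.End.mul_apply, ih]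
      have h1 : ∀ j, e ((f - 1) x) i j = if h : (j : ℕ) + 1 < d i then e x i ⟨j + 1, h⟩ else 0 := by
        intro j
        have : (f - 1) x = f x - x := rfl
        rw [this, map_sub, Pi.sub_apply, Pi.sub_apply, he, jordanBlock_mulVec_apply,
          add_sub_cancel_left]
      simp only [h1]
      by_cases h2 : (j : ℕ) + (k + 1) < d i
      · rw [dif_pos h2, dif_pos (by omega), dif_pos (by omega)]
        rfl
      · rw [dif_neg h2]
        split_ifs
        · omega
        · rfl
        · rfl
  have hker : ∀ x, x ∈ LinearMap.ker ((f - 1) ^ k) ↔ ∀ i (j : Fin (d i)), k ≤ j → e x i j = 0 := by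
    intro x
    rw [LinearMap.mem_ker, ← e.map_eq_zero_iff]
    constructor
    · intro h i j hj
      have := congrFun (congrFun h i) ⟨j - k, by omega⟩
      rw [hpow] at this
      have h2 : (j : ℕ) - k + k = j := by omega
      simpa [h2] using this
    · intro h
      funext i j
      rw [hpow]
      split_ifs with h2
      · exact h i _ (by simp)
      · rfl
  let Φ : LinearMap.ker ((f - 1) ^ k) ≃ₗ[F] (∀ i, Fin (min (d i) k) → F) :=
    { toFun := fun x i j => e x i (Fin.castLE (min_le_left _ _) j)
      invFun := fun y => ⟨e.symm fun i j => if h : (j : ℕ) < min (d i) k then y i ⟨j, h⟩ else 0, by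
        rw [hker]
        intro i j hj
        rw [LinearEquiv.apply_symm_apply, dif_neg (by omega)]⟩
      left_inv := fun x => by
        apply Subtype.ext
        apply e.injective
        rw [LinearEquiv.apply_symm_apply]
        funext i j
        split_ifs with h
        · rfl
        · exact ((hker x).1 x.2 i j (by omega)).symm
      right_inv := fun y => by
        funext i j
        change e (e.symm _) i _ = _
        rw [LinearEquiv.apply_symm_apply]
        exact dif_pos j.2
      map_add' := fun x y => by
        funext i j
        exact congrFun (congrFun (map_add e (x : V) y) i) _
      map_smul' := fun c x => by
        funext i j
        exact congrFun (congrFun (map_smul e c (x : V)) i) _ }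
  rw [Φ.finrank_eq, Module.finrank_pi_fintype]
  simp

theorem two_mul_sum_min {ι : Type*} [Fintype ι] (d : ι → ℕ) {q : ℕ} (hq : 1 ≤ q) :
    2 * ∑ i, min (d i) q = (∑ i, (if d i = q then 1 else 0)) +
      (∑ i, min (d i) (q - 1) + ∑ i, min (d i) (q + 1)) := by
  rw [Finset.mul_sum, ← Finset.sum_add_distrib, ← Finset.sum_add_distrib]
  refine Finset.sum_congr rfl fun i _ => ?_
  split_ifs <;> omega

/-- The number of Jordan blocks of size `q` is the second difference of the dimensions of the
kernels of the powers of `f - 1`. -/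
theorem IsJordanFamily.card_eq {ι ι' : Type*} [Fintype ι] [Fintype ι'] {d : ι → ℕ} {d' : ι' → ℕ}
    (h : IsJordanFamily f d) (h' : IsJordanFamily f d') {q : ℕ} (hq : 1 ≤ q) :
    ∑ i, (if d i = q then 1 else 0) = ∑ i, (if d' i = q then 1 else 0) := by
  have hk : ∀ k, ∑ i, min (d i) k = ∑ i, min (d' i) k := fun k => by
    rw [← IsJordanFamily.finrank_ker_pow (f := f) h, ← IsJordanFamily.finrank_ker_pow (f := f) h']
  have h1 := two_mul_sum_min d hq
  have h2 := two_mul_sum_min d' hq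
  rw [hk, hk, hk] at h1
  omega

theorem HasJordanBlocks.eq_sum {p : ℕ} {ℓ : ℕ → ℕ} (h : HasJordanBlocks p f ℓ) {ι : Type*}
    [Fintype ι] {d : ι → ℕ} (h' : IsJordanFamily f d) {q : ℕ} (hq : 1 ≤ q) (hqp : q ≤ p) :
    ℓ q = ∑ i, (if d i = q then 1 else 0) := by
  rw [← h.isJordanFamily.card_eq h' hq, Fintype.sum_sigma,
    Finset.sum_eq_single_of_mem ⟨q, Finset.mem_Icc.2 ⟨hq, hqp⟩⟩ (Finset.mem_univ _)]
  · simp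
  · intro b _ hb
    refine Finset.sum_eq_zero fun i _ => if_neg fun h => hb (Subtype.ext h)

end Jordan

/-! ### Jordan blocks of a Curtis–Reiner decomposition -/

theorem sub_one_smul {R M : Type*} [CommRing R] [AddCommGroup M] [Module R M] (c : R) (x : M) :
    (c - 1) • x = c • x - x := by
  rw [sub_smul, one_smul]

section Blocks

variable {K : Type*} [Field K] {p : ℕ} {ξ : K}

theorem idealAction_sub_one_apply (A : Ideal (RootRing ξ)) (x : A) :
    (idealAction A - 1 : Module.End ℤ A) x = (root ξ - 1) • x :=
  (sub_one_smul (root ξ) x).symm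

theorem idealAction_sub_one_pow (A : Ideal (RootRing ξ)) (n : ℕ) (x : A) :
    ((idealAction A - 1 : Module.End ℤ A) ^ n) x = (root ξ - 1) ^ n • x := by
  induction n with
  | zero => simp
  | succ n ih =>
    rw [pow_succ', Module.End.mul_apply, ih, pow_succ', mul_smul, idealAction_sub_one_apply]

theorem extensionAction_sub_one_apply (A : Ideal (RootRing ξ)) (a : A) (x : A × ℤ) :
    (extensionAction A a - 1 : Module.End ℤ (A × ℤ)) x = ((root ξ - 1) • x.1 + x.2 • a, 0) := by
  refine Prod.ext ?_ (sub_self _)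
  refine Eq.trans ?_ (congrArg (· + x.2 • a) (sub_one_smul (root ξ) x.1).symm)
  exact add_sub_right_comm _ _ _

theorem extensionAction_sub_one_pow (A : Ideal (RootRing ξ)) (a : A) (n : ℕ) :
    ((extensionAction A a - 1 : Module.End ℤ (A × ℤ)) ^ (n + 1)) (0, 1) =
      ((root ξ - 1) ^ n • a, 0) := by
  induction n with
  | zero => rw [zero_add, pow_one, extensionAction_sub_one_apply]; simp
  | succ n ih =>
    rw [pow_succ', Module.End.mul_apply, ih, extensionAction_sub_one_apply, pow_succ', mul_smul,
      zero_smul, add_zero]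

variable [Fact p.Prime] [CharZero K]

theorem exists_mem_notMem_mul [IsCyclotomicExtension {p} ℚ K] (hξ : IsPrimitiveRoot ξ p)
    {A : Ideal (RootRing ξ)} (hA : A ≠ ⊥) :
    ∃ b : A, (b : RootRing ξ) ∉ Ideal.span {root ξ - 1} * A := by
  have := isDedekindDomain_rootRing hξ
  by_contra! h
  have h1 : Ideal.span {root ξ - 1} * A = 1 * A := by
    rw [one_mul]
    exact le_antisymm Ideal.mul_le_right fun x hx => h ⟨x, hx⟩
  refine (isMaximal_span_root_sub_one hξ).ne_top ?_
  rw [← Ideal.one_eq_top]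
  exact mul_right_cancel₀ hA h1

theorem finrank_ideal (hξ : IsPrimitiveRoot ξ p) {A : Ideal (RootRing ξ)} (hA : A ≠ ⊥) :
    Module.finrank ℤ A = p - 1 := by
  have := finite_rootRing hξ
  rw [← finrank_rootRing hξ]
  exact Ideal.finrank_eq_finrank (Module.finBasis ℤ (RootRing ξ)) A hA

/-- A vector outside `(ξ - 1) A` generates the ideal `A` over `ℤ[ξ]` modulo `p`. -/
theorem exists_eq_sum_add_prime_nsmul [IsCyclotomicExtension {p} ℚ K] (hξ : IsPrimitiveRoot ξ p)
    {A : Ideal (RootRing ξ)} {b : A} (hb : (b : RootRing ξ) ∉ Ideal.span {root ξ - 1} * A) (x : A) :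
    ∃ (c : ℕ → ℤ) (y : A),
      x = ∑ i ∈ Finset.range (p - 1), c i • (root ξ - 1) ^ i • b + p • y := by
  have h1 : ∀ x : A, ∃ (c : ℤ) (y : A), x = c • b + (root ξ - 1) • y := fun x => by
    obtain ⟨c, y, hy, h⟩ := exists_int_smul_add hξ b.2 hb x.2
    exact ⟨c, ⟨y, hy⟩, Subtype.ext (by simpa using h)⟩
  have h2 : ∀ n : ℕ, ∃ (c : ℕ → ℤ) (y : A),
      x = ∑ i ∈ Finset.range n, c i • (root ξ - 1) ^ i • b + (root ξ - 1) ^ n • y := by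
    intro n
    induction n with
    | zero => exact ⟨0, x, by simp⟩
    | succ n ih =>
      obtain ⟨c, y, hc⟩ := ih
      obtain ⟨k, z, hk⟩ := h1 y
      refine ⟨Function.update c n k, z, ?_⟩
      rw [Finset.sum_range_succ, Function.update_self, hc, hk, smul_add, ← add_assoc, pow_succ,
        mul_smul, smul_comm _ k b]
      congr 2
      refine Finset.sum_congr rfl fun i hi => ?_
      rw [Function.update_of_ne (Finset.mem_range.1 hi).ne]
  obtain ⟨c, y, hc⟩ := h2 (p - 1)
  obtain ⟨w, hw⟩ := prime_dvd_root_sub_one_pow hξ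
  refine ⟨c, w • y, hc.trans ?_⟩
  rw [hw, mul_smul, Nat.cast_smul_eq_nsmul]

theorem isJordanReduction_ideal [IsCyclotomicExtension {p} ℚ K] (hξ : IsPrimitiveRoot ξ p)
    {A : Ideal (RootRing ξ)} (hA : A ≠ ⊥) :
    IsJordanReduction p (idealAction A) fun _ : Unit => p - 1 := by
  have := finite_rootRing hξ
  obtain ⟨b, hb⟩ := exists_mem_notMem_mul hξ hA
  have : Module.Finite ℤ A := inferInstanceAs (Module.Finite ℤ (A.restrictScalars ℤ))
  have : Module.Free ℤ A := inferInstanceAs (Module.Free ℤ (A.restrictScalars ℤ))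
  refine isJordanReduction_of_cyclic _ (finrank_ideal hξ hA) b ?_ ?_
  · simp only [idealAction_sub_one_pow]
    exact exists_eq_sum_add_prime_nsmul hξ hb
  · obtain ⟨w, hw⟩ := prime_dvd_root_sub_one_pow hξ
    exact ⟨w • b, by rw [idealAction_sub_one_pow, hw, mul_smul, Nat.cast_smul_eq_nsmul]⟩

theorem isJordanReduction_extension [IsCyclotomicExtension {p} ℚ K] (hξ : IsPrimitiveRoot ξ p)
    {A : Ideal (RootRing ξ)} {a : A} (ha : (a : RootRing ξ) ∉ Ideal.span {root ξ - 1} * A) :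
    IsJordanReduction p (extensionAction A a) fun _ : Unit => p := by
  have hp : p - 1 + 1 = p := Nat.sub_add_cancel (Fact.out : p.Prime).one_le
  have := finite_rootRing hξ
  have hA : A ≠ ⊥ := by
    rintro rfl
    exact ha (by rw [Ideal.mem_bot.1 a.2]; exact Ideal.zero_mem _)
  have : Module.Finite ℤ A := inferInstanceAs (Module.Finite ℤ (A.restrictScalars ℤ))
  have : Module.Free ℤ A := inferInstanceAs (Module.Free ℤ (A.restrictScalars ℤ))
  refine isJordanReduction_of_cyclic _ ?_ (0, 1) ?_ ?_
  · rw [Module.finrank_prod, finrank_ideal hξ hA, Module.finrank_self, hp]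
  · rintro ⟨x, k⟩
    obtain ⟨c, y, hc⟩ := exists_eq_sum_add_prime_nsmul hξ ha x
    refine ⟨fun i => Nat.casesOn i k c, (y, 0), ?_⟩
    rw [← hp, Finset.sum_range_succ']
    simp only [extensionAction_sub_one_pow]
    refine Prod.ext ?_ ?_
    · rw [hp]
      simpa [Prod.fst_sum] using hc
    · simp [Prod.snd_sum]
  · obtain ⟨w, hw⟩ := prime_dvd_root_sub_one_pow hξ
    refine ⟨(w • a, 0), ?_⟩
    rw [← hp, extensionAction_sub_one_pow, hp, hw, mul_smul, Nat.cast_smul_eq_nsmul]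
    simp

theorem isJordanReduction_int :
    IsJordanReduction p (LinearMap.id : ℤ →ₗ[ℤ] ℤ) fun _ : Unit => 1 := by
  refine isJordanReduction_of_cyclic _ (Module.finrank_self ℤ) 1 (fun x => ⟨fun _ => x, 0, ?_⟩)
    ⟨0, ?_⟩
  · simp
  · have : (LinearMap.id : Module.End ℤ ℤ) - 1 = 0 := sub_self _
    rw [this]
    simp

/-- A decomposition of type `(r, s, t)` reduces modulo `p` to `r` blocks of size `p`, `s` blocks of
size `p - 1` and `t` blocks of size `1`. -/
theorem HasDecomposition.isJordanFamily [IsCyclotomicExtension {p} ℚ K]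
    (hξ : IsPrimitiveRoot ξ p) {T : Type*} [AddCommGroup T] {f : T →ₗ[ℤ] T} {r s t : ℕ}
    (h : HasDecomposition ξ f r s t) :
    IsJordanFamily (f.baseChange (ZMod p))
      (Sum.elim (fun _ : Fin r => p) (Sum.elim (fun _ : Fin s => p - 1) fun _ : Fin t => 1)) := by
  obtain ⟨A, a, B, e, ha, hB, h⟩ := h
  let g₁ : (∀ i, A i × ℤ) →ₗ[ℤ] (∀ i, A i × ℤ) :=
    LinearMap.pi fun i => (extensionAction (A i) (a i)).comp (LinearMap.proj i)
  let g₂ : (∀ j, B j) →ₗ[ℤ] (∀ j, B j) :=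
    LinearMap.pi fun j => (idealAction (B j)).comp (LinearMap.proj j)
  have h₁ : IsJordanReduction p g₁ fun _ => p :=
    IsJordanReduction.pi _ (fun _ _ => rfl) fun i => isJordanReduction_extension hξ (ha i)
  have h₂ : IsJordanReduction p g₂ fun _ => p - 1 :=
    IsJordanReduction.pi _ (fun _ _ => rfl) fun j => isJordanReduction_ideal hξ (hB j)
  have h₃ : IsJordanReduction p (LinearMap.id : (Fin t → ℤ) →ₗ[ℤ] (Fin t → ℤ)) fun _ => 1 :=
    IsJordanReduction.pi _ (fun _ _ => rfl) fun _ => isJordanReduction_int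
  refine ((h₁.prod (h₂.prod h₃)).of_equiv e.toAddEquiv fun x => ?_).isJordanFamily
  exact Prod.ext (funext (h x).1) (Prod.ext (funext (h x).2.1) (h x).2.2)

end Blocks

/-! ### Ranks of invariants -/

/-- For the vectors `(x, k)` of `N i × ℤ` with `π x + k a = 0`, the projection to `ℤ` is injective
because `π` acts injectively on `N i`, and its image contains `m ℤ` because `π` divides `m`. -/
theorem finrank_eq_of_mem_iff {R : Type*} [CommRing R] {r s t : ℕ} {N : Fin r → Type*}
    {N' : Fin s → Type*} [∀ i, AddCommGroup (N i)] [∀ i, Module R (N i)]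
    [∀ j, AddCommGroup (N' j)] {π u : R} {m : ℕ} (hm : m ≠ 0) (hu : (m : R) = π * u)
    (hN : ∀ i (x : N i), π • x = 0 → x = 0) (a : ∀ i, N i) {T : Type*} [AddCommGroup T]
    [Module.Free ℤ T] [Module.Finite ℤ T]
    (e : T ≃+ (∀ i, N i × ℤ) × (∀ j, N' j) × (Fin t → ℤ)) (S : Submodule ℤ T)
    (hS : ∀ x, x ∈ S ↔ (∀ i, π • ((e x).1 i).1 + ((e x).1 i).2 • a i = 0) ∧
      ∀ j, (e x).2.1 j = 0) :
    Module.finrank ℤ S = r + t := by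
  let Φ : S →ₗ[ℤ] (Fin r → ℤ) × (Fin t → ℤ) := AddMonoidHom.toIntLinearMap
    { toFun := fun x => (fun i => ((e x).1 i).2, (e x).2.2)
      map_zero' := by
        rw [ZeroMemClass.coe_zero, map_zero]
        rfl
      map_add' := fun x y => by
        rw [Submodule.coe_add, map_add]
        rfl }
  have hΦ : Function.Injective Φ := by
    rw [← LinearMap.ker_eq_bot, LinearMap.ker_eq_bot']
    intro x hx
    obtain ⟨hx1, hx2⟩ := (hS x).1 x.2
    have hx3 : ∀ i, ((e x).1 i).2 = 0 := fun i => congrFun (congrArg Prod.fst hx) i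
    have hx4 : (e x).2.2 = 0 := congrArg Prod.snd hx
    apply Subtype.ext
    rw [ZeroMemClass.coe_zero, ← e.map_eq_zero_iff]
    refine Prod.ext (funext fun i => Prod.ext (hN _ _ ?_) (hx3 i)) (Prod.ext (funext hx2) hx4)
    simpa [hx3] using hx1 i
  -- The vector `(-(k u a), m k)` satisfies the equation because `m = π u`.
  let Ψ : (Fin r → ℤ) × (Fin t → ℤ) →ₗ[ℤ] S := AddMonoidHom.toIntLinearMap
    { toFun := fun y => ⟨e.symm (fun i => (-(y.1 i • u • a i), m * y.1 i), 0, y.2), by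
        rw [hS, AddEquiv.apply_symm_apply]
        refine ⟨fun i => ?_, fun j => rfl⟩
        change π • -(y.1 i • u • a i) + ((m : ℤ) * y.1 i) • a i = 0
        rw [smul_neg, smul_comm _ (y.1 i), smul_smul, ← hu, mul_comm, mul_smul, natCast_zsmul,
          Nat.cast_smul_eq_nsmul, neg_add_cancel]⟩
      map_zero' := by
        apply Subtype.ext
        apply e.injective
        rw [AddEquiv.apply_symm_apply, ZeroMemClass.coe_zero, map_zero]
        refine Prod.ext (funext fun i => Prod.ext ?_ ?_) rfl
        · change -((0 : ℤ) • u • a i) = 0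
          rw [zero_smul, neg_zero]
        · exact mul_zero _
      map_add' := fun x y => by
        apply Subtype.ext
        apply e.injective
        rw [Submodule.coe_add, map_add, AddEquiv.apply_symm_apply, AddEquiv.apply_symm_apply,
          AddEquiv.apply_symm_apply]
        refine Prod.ext (funext fun i => Prod.ext ?_ ?_) (Prod.ext (add_zero _).symm rfl)
        · change -((x.1 i + y.1 i) • u • a i) = -(x.1 i • u • a i) + -(y.1 i • u • a i)
          rw [add_smul, neg_add]
        · exact mul_add _ _ _ }
  have hΨ : Function.Injective Ψ := by
    rw [← LinearMap.ker_eq_bot, LinearMap.ker_eq_bot']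
    intro y hy
    have h1 := congrArg e (congrArg Subtype.val hy)
    rw [ZeroMemClass.coe_zero, map_zero] at h1
    change e (e.symm _) = 0 at h1
    rw [AddEquiv.apply_symm_apply] at h1
    refine Prod.ext (funext fun i => ?_) (congrArg (fun z => z.2.2) h1)
    have h2 : (m : ℤ) * y.1 i = 0 := congrArg (fun z => (z.1 i).2) h1
    exact (mul_eq_zero.1 h2).resolve_left (by exact_mod_cast hm)
  have hrank : Module.finrank ℤ ((Fin r → ℤ) × (Fin t → ℤ)) = r + t := by simp
  rw [← hrank]
  exact le_antisymm (LinearMap.finrank_le_finrank_of_injective hΦ)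
    (LinearMap.finrank_le_finrank_of_injective hΨ)

theorem HasDecomposition.finrank_ker {K : Type*} [Field K] [CharZero K] {p : ℕ} [Fact p.Prime]
    {ξ : K} (hξ : IsPrimitiveRoot ξ p) {T : Type*} [AddCommGroup T]
    [Module.Free ℤ T] [Module.Finite ℤ T] {f : Module.End ℤ T} {r s t : ℕ}
    (h : HasDecomposition ξ f r s t) :
    Module.finrank ℤ (LinearMap.ker (f - 1)) = r + t := by
  obtain ⟨A, a, B, e, -, -, h⟩ := h
  obtain ⟨u, hu⟩ := root_sub_one_dvd_prime hξ
  have hcancel : ∀ (I : Ideal (RootRing ξ)) (x : I), (root ξ - 1) • x = 0 → x = 0 :=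
    fun I x hx => (smul_eq_zero.1 hx).resolve_left (root_sub_one_ne_zero hξ)
  refine finrank_eq_of_mem_iff (Fact.out : p.Prime).ne_zero hu (fun i => hcancel (A i)) a
    e.toAddEquiv _ fun x => ?_
  have h0 : x ∈ LinearMap.ker (f - 1) ↔ e (f x) = e x := by
    rw [LinearMap.mem_ker, e.injective.eq_iff, LinearMap.sub_apply, sub_eq_zero]
    rfl
  have hA : ∀ i, (e (f x)).1 i = (e x).1 i ↔
      (root ξ - 1) • ((e x).1 i).1 + ((e x).1 i).2 • a i = 0 := by
    intro i
    rw [(h x).1, ← sub_eq_zero]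
    have := extensionAction_sub_one_apply (A i) (a i) ((e x).1 i)
    change extensionAction (A i) (a i) ((e x).1 i) - (e x).1 i = _ at this
    rw [this, Prod.mk_eq_zero, and_iff_left rfl]
  have hB : ∀ j, (e (f x)).2.1 j = (e x).2.1 j ↔ (e x).2.1 j = 0 := by
    intro j
    rw [(h x).2.1, ← sub_eq_zero]
    have := idealAction_sub_one_apply (B j) ((e x).2.1 j)
    change idealAction (B j) ((e x).2.1 j) - (e x).2.1 j = _ at this
    rw [this]
    exact ⟨hcancel _ _, fun h => by rw [h, smul_zero]⟩
  rw [h0, Prod.ext_iff, Prod.ext_iff, funext_iff, funext_iff]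
  simp only [hA, hB, (h x).2.2, and_true]
  rfl

end CurtisReiner

theorem mainTheorem6 (p : ℕ) [Fact p.Prime]
    {K : Type*} [Field K] [CharZero K] [IsCyclotomicExtension {p} ℚ K]
    (ξ : K) (hξ : IsPrimitiveRoot ξ p)
    {G : Type*} [Group G] (hG : Nat.card G = p)
    (φ : G) (hφ : Subgroup.zpowers φ = ⊤)
    {T : Type*} [AddCommGroup T] [Module.Free ℤ T] [Module.Finite ℤ T]
    (ρ : Representation ℤ G T) :
    (∃ r s t : ℕ, CurtisReiner.HasDecomposition ξ (ρ φ) r s t) ∧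
    (∃ ℓ : ℕ → ℕ, CurtisReiner.HasJordanBlocks p ((ρ φ).baseChange (ZMod p)) ℓ) ∧
    ∀ (r s t : ℕ) (ℓ : ℕ → ℕ),
      CurtisReiner.HasDecomposition ξ (ρ φ) r s t →
      CurtisReiner.HasJordanBlocks p ((ρ φ).baseChange (ZMod p)) ℓ →
        ℓ p = r ∧
        (3 ≤ p → ℓ 1 = t ∧ ℓ (p - 1) = s) ∧
        (p = 2 → ℓ 1 = t + s) ∧
        (∀ q : ℕ, 2 ≤ q → q + 2 ≤ p → ℓ q = 0) ∧
        Module.finrank ℤ T = t + (p - 1) * s + p * ℓ p ∧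
        Module.finrank ℤ ρ.invariants = t + ℓ p := by
  have hp2 : 2 ≤ p := (Fact.out : p.Prime).two_le
  have hφp : (ρ φ) ^ p = 1 := by rw [← map_pow, ← hG, pow_card_eq_one', map_one]
  obtain ⟨r₀, s₀, t₀, h₀⟩ := CurtisReiner.exists_hasDecomposition hξ (ρ φ) hφp
  refine ⟨⟨r₀, s₀, t₀, h₀⟩, ⟨_, (h₀.isJordanFamily hξ).hasJordanBlocks (p := p) ?_⟩, ?_⟩
  · rintro (i | i | i) <;> simp only [Sum.elim_inl, Sum.elim_inr, Finset.mem_Icc] <;> omega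
  intro r s t ℓ h hℓ
  have hfam := h.isJordanFamily hξ
  have hcount : ∀ q, 1 ≤ q → q ≤ p → ℓ q = (if p = q then r else 0) +
      ((if p - 1 = q then s else 0) + if 1 = q then t else 0) := by
    intro q hq hqp
    rw [hℓ.eq_sum hfam hq hqp]
    have hsum : ∀ n m : ℕ, ∑ _i : Fin n, (if m = q then 1 else 0) = if m = q then n else 0 := by
      intro n m
      split_ifs <;> simp
    rw [Fintype.sum_sum_type, Fintype.sum_sum_type]
    exact congrArg₂ _ (hsum r p) (congrArg₂ _ (hsum s (p - 1)) (hsum t 1))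
  have hr : ℓ p = r := by
    rw [hcount p (by omega) le_rfl, if_pos rfl, if_neg (by omega), if_neg (by omega)]
    rfl
  refine ⟨hr, fun h3 => ⟨?_, ?_⟩, fun h2 => ?_, fun q hq hqp => ?_, ?_, ?_⟩
  · rw [hcount 1 le_rfl (by omega), if_neg (by omega), if_neg (by omega), if_pos rfl]
    omega
  · rw [hcount (p - 1) (by omega) (by omega), if_neg (by omega), if_pos rfl, if_neg (by omega)]
    omega
  · rw [hcount 1 le_rfl (by omega), if_neg (by omega), if_pos (by omega), if_pos rfl]
    omega
  · rw [hcount q (by omega) (by omega), if_neg (by omega), if_neg (by omega), if_neg (by omega)]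
  · rw [← Module.finrank_baseChange (R := ZMod p), hfam.finrank_eq, hr]
    simp only [Fintype.sum_sum_type, Sum.elim_inl, Sum.elim_inr, Finset.sum_const,
      Finset.card_univ, Fintype.card_fin, smul_eq_mul]
    ring
  · have hinv : ρ.invariants = LinearMap.ker (ρ φ - 1) := by
      ext x
      rw [Representation.mem_invariants, LinearMap.mem_ker, LinearMap.sub_apply, sub_eq_zero]
      refine ⟨fun h => h φ, fun h g => ?_⟩
      have hg : g ∈ Subgroup.zpowers φ := hφ ▸ Subgroup.mem_top g
      rw [← (isOfFinOrder_iff_pow_eq_one.2 ⟨p, by omega, by rw [← hG, pow_card_eq_one']⟩ :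
        IsOfFinOrder φ).mem_powers_iff_mem_zpowers] at hg
      obtain ⟨n, rfl⟩ := hg
      change ρ (φ ^ n) x = x
      rw [map_pow]
      induction n with
      | zero => rfl
      | succ n ih => rw [pow_succ, Module.End.mul_apply, h]; exact ih
    rw [hinv, h.finrank_ker hξ, hr, add_comm]
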